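/- For a sequence $x=(x_i)_{i\in\mathbb N}$ ($\mathbb N=\{1,2,\dots\}$) of pairwise distinct positive numbers, the sampled Laplace transform with sampling points $x_i$ (and unit weights) is the operator $$L: L^2(0,\infty)\to\ell^2,\qquad (Lf)_i=\int_0^\infty e^{-x_i t}f(t)\,dt ,\quad i\in\mathbb N,$$ where $L^2(0,\infty)$ and $\ell^2$ are both taken over $\mathbb R$ or both over $\mathbb C$. For a bounded linear operator $T$ between Hilbert spaces, the inversion of $T$ is called ill-posed if the range of $T$ is not closed; an ill-posed problem is of type I if $T$ is not compact, and of type II if $T$ is compact. Let $0<s<1$. (1) If $x_i=i-s$ for $i\in\mathbb N$, then $L$ is a well-defined bounded operator, it is not compact, and its inversion is an ill-posed problem of type I. (2) If $x_i=i^\alpha-s$ for $i\in\mathbb N$ with $\alpha>1$, then $L$ is a well-defined bounded operator, it is compact, and its inversion is an ill-posed problem of type II. -/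

import Mathlib

open MeasureTheory Set

/-- The real or complex space `L²(0,∞)`. -/
abbrev L2HalfLine (𝕜 : Type*) [RCLike 𝕜] : Type _ :=
  Lp 𝕜 2 ((volume : Measure ℝ).restrict (Ioi 0))

/-- The real or complex sequence space `ℓ²`; the entry with index `n : ℕ` is the `(n+1)`-st one. -/
abbrev EllTwo (𝕜 : Type*) [RCLike 𝕜] : Type _ :=
  lp (fun _ : ℕ => 𝕜) 2

/-- The bounded operator `L : L²(0,∞) → ℓ²` is the sampled Laplace transform with weights `d` and
sampling points `x`: the integral `∫₀^∞ e^{-xₙ t} f(t) dt` converges absolutely for all `f` and `n`,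
and `(L f)ₙ = dₙ ∫₀^∞ e^{-xₙ t} f(t) dt`. -/
def IsSampledLaplaceTransform {𝕜 : Type*} [RCLike 𝕜] (d x : ℕ → ℝ)
    (L : L2HalfLine 𝕜 →L[𝕜] EllTwo 𝕜) : Prop :=
  ∀ (f : L2HalfLine 𝕜) (n : ℕ),
    IntegrableOn (fun t : ℝ => (Real.exp (-(x n * t)) : 𝕜) * f t) (Ioi 0) ∧
      L f n = (d n : 𝕜) * ∫ t in Ioi (0 : ℝ), (Real.exp (-(x n * t)) : 𝕜) * f t

/-- There is at most one such operator. -/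
theorem IsSampledLaplaceTransform.unique {𝕜 : Type*} [RCLike 𝕜] {d x : ℕ → ℝ}
    {L L' : L2HalfLine 𝕜 →L[𝕜] EllTwo 𝕜} (h : IsSampledLaplaceTransform d x L)
    (h' : IsSampledLaplaceTransform d x L') : L = L' := by
  refine ContinuousLinearMap.ext fun f => ?_
  refine lp.ext (funext fun n => ?_)
  rw [(h f n).2, (h' f n).2]

section IllPosed

variable {𝕜 E F : Type*} [RCLike 𝕜] [NormedAddCommGroup E] [NormedSpace 𝕜 E]
  [NormedAddCommGroup F] [NormedSpace 𝕜 F]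

/-- The inversion of `T` is ill-posed in the sense of Nashed: the range of `T` is not closed. -/
def IsIllPosed (T : E →L[𝕜] F) : Prop :=
  ¬ IsClosed (range T)

/-- The inversion of `T` is ill-posed of type I: it is ill-posed and `T` is not compact. -/
def IsIllPosedTypeI (T : E →L[𝕜] F) : Prop :=
  IsIllPosed T ∧ ¬ IsCompactOperator T

/-- The inversion of `T` is ill-posed of type II: it is ill-posed and `T` is compact. -/
def IsIllPosedTypeII (T : E →L[𝕜] F) : Prop :=
  IsIllPosed T ∧ IsCompactOperator T

end IllPosed

/-! Boundedness is Schur's test with the weight `t ^ (-1/2)`. If `c * (n + 1) ≤ x n`, weighted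
Cauchy–Schwarz bounds each squared coordinate. Summing over `n` and comparing the series with an
integral gives `‖L f‖² ≤ (π / c) * ‖f‖²`.

Ill-posedness needs only sampling points strictly increasing to infinity. The transform of the
indicator of `(T, T + 1]` is that of `(0, 1]` with coordinate `n` multiplied by `exp (-x n * T)`.
For large `T` the lowest remaining coordinate dominates, so a closed range contains every unit
vector by induction, hence is all of `ℓ²`. The open mapping theorem then gives bounded preimages of
the unit vectors, contradicting `|(L f)ₙ|² ≤ ‖f‖² / (2 * x n)`.

Compactness depends on the growth of `x`. If `∑ 1 / x n` converges, as for `α > 1`, that coordinate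
bound makes `L` a norm limit of finite-rank truncations. If `x n ≤ n + 1`, normalized indicators of
`(0, 1 / (k + 1)]` have images that vanish coordinatewise but stay bounded away from zero in norm.
-/

/-! ### The Laplace integral as a functional on `L²(0,∞)` -/

/-- Decaying exponentials belong to `L²(0,∞)`. -/
theorem memLp_exp_neg_mul (𝕜 : Type*) [RCLike 𝕜] {x : ℝ} (hx : 0 < x) :
    MemLp (fun t : ℝ => (Real.exp (-(x * t)) : 𝕜)) 2 ((volume : Measure ℝ).restrict (Ioi 0)) := by
  have hc : Continuous fun t : ℝ => (Real.exp (-(x * t)) : 𝕜) :=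
    RCLike.continuous_ofReal.comp (by fun_prop)
  rw [memLp_two_iff_integrable_sq_norm hc.aestronglyMeasurable]
  refine (integrableOn_exp_mul_Ioi (a := -(2 * x)) (by linarith) 0).congr_fun (fun t _ => ?_)
    measurableSet_Ioi
  simp only [RCLike.norm_ofReal, abs_of_pos (Real.exp_pos _)]
  rw [← Real.exp_nat_mul]
  congr 1
  push_cast
  ring

/-- The Laplace integral of a square-integrable function converges absolutely. -/
theorem integrableOn_exp_neg_mul_mul {𝕜 : Type*} [RCLike 𝕜] {x : ℝ} (hx : 0 < x)
    (f : L2HalfLine 𝕜) :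
    IntegrableOn (fun t : ℝ => (Real.exp (-(x * t)) : 𝕜) * f t) (Ioi 0) :=
  (memLp_exp_neg_mul 𝕜 hx).integrable_mul (Lp.memLp f)

/-- The Laplace integral as a linear functional on `L²(0,∞)`. -/
noncomputable def laplaceFunctional (𝕜 : Type*) [RCLike 𝕜] (x : ℝ) (hx : 0 < x) :
    L2HalfLine 𝕜 →ₗ[𝕜] 𝕜 where
  toFun f := ∫ t in Ioi (0 : ℝ), (Real.exp (-(x * t)) : 𝕜) * f t
  map_add' f g := by
    rw [← integral_add (integrableOn_exp_neg_mul_mul hx f) (integrableOn_exp_neg_mul_mul hx g)]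
    refine integral_congr_ae ?_
    filter_upwards [Lp.coeFn_add f g] with t ht
    rw [ht, Pi.add_apply, mul_add]
  map_smul' c f := by
    rw [RingHom.id_apply, smul_eq_mul, ← integral_const_mul]
    refine integral_congr_ae ?_
    filter_upwards [Lp.coeFn_smul c f] with t ht
    rw [ht, Pi.smul_apply, smul_eq_mul, mul_left_comm]

theorem laplaceFunctional_apply {𝕜 : Type*} [RCLike 𝕜] {x : ℝ} (hx : 0 < x) (f : L2HalfLine 𝕜) :
    laplaceFunctional 𝕜 x hx f = ∫ t in Ioi (0 : ℝ), (Real.exp (-(x * t)) : 𝕜) * f t :=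
  rfl

/-- The square of the norm of an element of `L²(0,∞)` as an integral. -/
theorem lintegral_enorm_sq_eq {𝕜 : Type*} [RCLike 𝕜] (f : L2HalfLine 𝕜) :
    ∫⁻ t in Ioi (0 : ℝ), ‖f t‖ₑ ^ 2 = ENNReal.ofReal (‖f‖ ^ 2) := by
  rw [ENNReal.ofReal_pow (norm_nonneg _), ofReal_norm, Lp.enorm_def,
    eLpNorm_eq_lintegral_rpow_enorm_toReal (by norm_num) (by norm_num), ← ENNReal.rpow_natCast,
    ← ENNReal.rpow_mul]
  norm_num

/-! ### Weighted Cauchy–Schwarz and Schur's test -/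

/-- The Cauchy–Schwarz inequality for the Laplace integral with a weight `w`. -/
theorem enorm_laplaceFunctional_sq_le {𝕜 : Type*} [RCLike 𝕜] {x : ℝ} (hx : 0 < x)
    {w : ℝ → ℝ} (hw : Measurable w) (hw₀ : ∀ t ∈ Ioi (0 : ℝ), 0 < w t) (f : L2HalfLine 𝕜) :
    ‖laplaceFunctional 𝕜 x hx f‖ₑ ^ 2 ≤
      (∫⁻ t in Ioi (0 : ℝ), ENNReal.ofReal (w t * Real.exp (-(x * t)))) *
        ∫⁻ t in Ioi (0 : ℝ), ENNReal.ofReal ((w t)⁻¹ * Real.exp (-(x * t))) * ‖f t‖ₑ ^ 2 := by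
  have hf : AEMeasurable (fun t => ‖f t‖ₑ) ((volume : Measure ℝ).restrict (Ioi 0)) :=
    (Lp.aestronglyMeasurable f).enorm
  have key := ENNReal.lintegral_mul_norm_pow_le
    (μ := (volume : Measure ℝ).restrict (Ioi 0))
    (f := fun t => ENNReal.ofReal (w t * Real.exp (-(x * t))))
    (g := fun t => ENNReal.ofReal ((w t)⁻¹ * Real.exp (-(x * t))) * ‖f t‖ₑ ^ 2)
    (by fun_prop) (by fun_prop) (p := 1 / 2) (q := 1 / 2) (by norm_num) (by norm_num) (by norm_num)
  have h₁ : ‖laplaceFunctional 𝕜 x hx f‖ₑ ≤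
      ∫⁻ t in Ioi (0 : ℝ), ENNReal.ofReal (w t * Real.exp (-(x * t))) ^ (1 / 2 : ℝ) *
        (ENNReal.ofReal ((w t)⁻¹ * Real.exp (-(x * t))) * ‖f t‖ₑ ^ 2) ^ (1 / 2 : ℝ) := by
    refine (enorm_integral_le_lintegral_enorm _).trans_eq
      (setLIntegral_congr_fun measurableSet_Ioi fun t ht => ?_)
    have hwt := hw₀ t ht
    rw [← ENNReal.mul_rpow_of_nonneg _ _ (by norm_num), ← mul_assoc,
      ← ENNReal.ofReal_mul (by positivity)]
    have : w t * Real.exp (-(x * t)) * ((w t)⁻¹ * Real.exp (-(x * t))) =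
        Real.exp (-(x * t)) ^ 2 := by
      field_simp
    rw [this, ENNReal.ofReal_pow (Real.exp_pos _).le, ← mul_pow, ← ENNReal.rpow_natCast,
      ← ENNReal.rpow_mul, enorm_mul]
    norm_num
    congr 1
    rw [← ofReal_norm, RCLike.norm_ofReal, abs_of_pos (Real.exp_pos _)]
  calc _ ≤ _ := pow_le_pow_left' (h₁.trans key) 2
    _ = _ := by
      rw [mul_pow, ← ENNReal.rpow_natCast, ← ENNReal.rpow_natCast, ← ENNReal.rpow_mul,
        ← ENNReal.rpow_mul]
      norm_num

/-- The Laplace transform of `t ↦ t ^ (-1/2)`. -/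
theorem lintegral_rpow_neg_half_mul_exp {u : ℝ} (hu : 0 < u) :
    ∫⁻ t in Ioi (0 : ℝ), ENNReal.ofReal (t ^ (-(1 / 2) : ℝ) * Real.exp (-(u * t))) =
      ENNReal.ofReal (√Real.pi * u ^ (-(1 / 2) : ℝ)) := by
  have h := Real.integral_rpow_mul_exp_neg_mul_Ioi (a := 1 / 2) (by norm_num) hu
  rw [Real.Gamma_one_half_eq] at h
  norm_num at h
  have hne : √Real.pi * u ^ (-(1 / 2) : ℝ) ≠ 0 := by positivity
  have h' : ∫ t in Ioi (0 : ℝ), t ^ (-(1 / 2) : ℝ) * Real.exp (-(u * t)) =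
      √Real.pi * u ^ (-(1 / 2) : ℝ) := by
    rw [h, mul_comm, Real.rpow_neg hu.le, Real.inv_rpow hu.le]
  rw [← h', ofReal_integral_eq_lintegral_ofReal]
  -- The Bochner integral of a non-integrable function is `0`, so the nonzero value already forces
  -- integrability.
  · exact not_imp_comm.1 integral_undef (h' ▸ hne)
  · filter_upwards [ae_restrict_mem measurableSet_Ioi] with t ht
    have : (0 : ℝ) < t := ht
    positivity

/-- Comparison of a series with the Laplace transform of `t ↦ t ^ (-1/2)`. -/
theorem tsum_rpow_neg_half_mul_exp_le {u : ℝ} (hu : 0 < u) :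
    ∑' n : ℕ, ENNReal.ofReal (((n : ℝ) + 1) ^ (-(1 / 2) : ℝ) * Real.exp (-(u * ((n : ℝ) + 1)))) ≤
      ENNReal.ofReal (√Real.pi * u ^ (-(1 / 2) : ℝ)) := by
  have hd : Pairwise (Function.onFun Disjoint fun n : ℕ => Ioc (n : ℝ) ((n : ℝ) + 1)) := by
    have := pairwise_disjoint_Ioc_add_intCast (0 : ℝ)
    intro m n hmn
    have := this (show (m : ℤ) ≠ n by exact_mod_cast hmn)
    simpa [Function.onFun] using this
  calc _ ≤ ∑' n : ℕ, ∫⁻ t in Ioc (n : ℝ) ((n : ℝ) + 1),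
        ENNReal.ofReal (t ^ (-(1 / 2) : ℝ) * Real.exp (-(u * t))) := by
        -- The integrand decreases, so on `(n, n + 1]` it is at least its value at the right
        -- endpoint.
        refine ENNReal.tsum_le_tsum fun n => ?_
        have : ∫⁻ _ in Ioc (n : ℝ) ((n : ℝ) + 1), ENNReal.ofReal
            (((n : ℝ) + 1) ^ (-(1 / 2) : ℝ) * Real.exp (-(u * ((n : ℝ) + 1)))) =
            ENNReal.ofReal
              (((n : ℝ) + 1) ^ (-(1 / 2) : ℝ) * Real.exp (-(u * ((n : ℝ) + 1)))) := by
          simp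
        rw [← this]
        refine setLIntegral_mono' measurableSet_Ioc fun t ht => ENNReal.ofReal_le_ofReal ?_
        have ht₀ : 0 < t := (Nat.cast_nonneg n).trans_lt ht.1
        refine mul_le_mul (Real.rpow_le_rpow_of_nonpos ht₀ ht.2 (by norm_num)) ?_
          (Real.exp_pos _).le (by positivity)
        have := mul_le_mul_of_nonneg_left ht.2 hu.le
        exact Real.exp_le_exp.2 (by linarith)
    _ = ∫⁻ t in ⋃ n : ℕ, Ioc (n : ℝ) ((n : ℝ) + 1),
        ENNReal.ofReal (t ^ (-(1 / 2) : ℝ) * Real.exp (-(u * t))) :=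
        (lintegral_iUnion (fun _ => measurableSet_Ioc) hd _).symm
    _ ≤ ∫⁻ t in Ioi (0 : ℝ), ENNReal.ofReal (t ^ (-(1 / 2) : ℝ) * Real.exp (-(u * t))) :=
        lintegral_mono_set (iUnion_subset fun n t ht => (Nat.cast_nonneg n).trans_lt ht.1)
    _ = _ := lintegral_rpow_neg_half_mul_exp hu

/-- Schur's test for the sampled Laplace transform. -/
theorem tsum_enorm_laplaceFunctional_sq_le {𝕜 : Type*} [RCLike 𝕜] {c : ℝ} (hc : 0 < c)
    {x : ℕ → ℝ} (hx : ∀ n, 0 < x n) (hcx : ∀ n : ℕ, c * ((n : ℝ) + 1) ≤ x n) (f : L2HalfLine 𝕜) :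
    ∑' n, ‖laplaceFunctional 𝕜 (x n) (hx n) f‖ₑ ^ 2 ≤ ENNReal.ofReal (Real.pi / c * ‖f‖ ^ 2) := by
  have hf : AEMeasurable (fun t => ‖f t‖ₑ) ((volume : Measure ℝ).restrict (Ioi 0)) :=
    (Lp.aestronglyMeasurable f).enorm
  -- The two Cauchy–Schwarz factors for `w t = t ^ (-1/2)`, with `x n` replaced by its lower bound:
  -- `a` is the first integral, `b` the kernel of the second.
  set a : ℕ → ℝ := fun n => √Real.pi * (c * ((n : ℝ) + 1)) ^ (-(1 / 2) : ℝ) with ha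
  set b : ℕ → ℝ → ℝ := fun n t =>
    (t ^ (-(1 / 2) : ℝ))⁻¹ * Real.exp (-(c * ((n : ℝ) + 1) * t)) with hb
  have hexp : ∀ n : ℕ, ∀ t ∈ Ioi (0 : ℝ),
      Real.exp (-(x n * t)) ≤ Real.exp (-(c * ((n : ℝ) + 1) * t)) := fun n t ht =>
    Real.exp_le_exp.2 (neg_le_neg (mul_le_mul_of_nonneg_right (hcx n) (le_of_lt ht)))
  calc ∑' n, ‖laplaceFunctional 𝕜 (x n) (hx n) f‖ₑ ^ 2
      ≤ ∑' n, ENNReal.ofReal (a n) *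
          ∫⁻ t in Ioi (0 : ℝ), ENNReal.ofReal (b n t) * ‖f t‖ₑ ^ 2 := by
        refine ENNReal.tsum_le_tsum fun n => (enorm_laplaceFunctional_sq_le (hx n)
          (w := fun t => t ^ (-(1 / 2) : ℝ)) (by fun_prop)
          (fun t ht => Real.rpow_pos_of_pos ht _) f).trans ?_
        rw [ha, ← lintegral_rpow_neg_half_mul_exp (by positivity)]
        refine mul_le_mul' (setLIntegral_mono' measurableSet_Ioi fun t ht => ?_)
          (setLIntegral_mono' measurableSet_Ioi fun t ht => ?_)
        · exact ENNReal.ofReal_le_ofReal (mul_le_mul_of_nonneg_left (hexp n t ht)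
            (Real.rpow_pos_of_pos ht _).le)
        · exact mul_le_mul_left (ENNReal.ofReal_le_ofReal (mul_le_mul_of_nonneg_left
            (hexp n t ht) (inv_pos.2 (Real.rpow_pos_of_pos ht _)).le)) _
    _ = ∫⁻ t in Ioi (0 : ℝ), ∑' n, ENNReal.ofReal (a n) *
          (ENNReal.ofReal (b n t) * ‖f t‖ₑ ^ 2) := by
        rw [lintegral_tsum (fun n => by simp only [hb]; fun_prop)]
        refine tsum_congr fun n => (lintegral_const_mul' _ _ ENNReal.ofReal_ne_top).symm
    _ ≤ ∫⁻ t in Ioi (0 : ℝ), ENNReal.ofReal (Real.pi / c) * ‖f t‖ₑ ^ 2 := by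
        refine setLIntegral_mono' measurableSet_Ioi fun t ht => ?_
        have ht₀ : (0 : ℝ) < t := ht
        simp_rw [← mul_assoc]
        rw [ENNReal.tsum_mul_right]
        refine mul_le_mul_left ?_ _
        have hterm : ∀ n : ℕ, ENNReal.ofReal (a n) * ENNReal.ofReal (b n t) =
            ENNReal.ofReal (√Real.pi * c ^ (-(1 / 2) : ℝ) * (t ^ (-(1 / 2) : ℝ))⁻¹) *
              ENNReal.ofReal (((n : ℝ) + 1) ^ (-(1 / 2) : ℝ) *
                Real.exp (-(c * t * ((n : ℝ) + 1)))) := by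
          intro n
          rw [← ENNReal.ofReal_mul (by positivity), ← ENNReal.ofReal_mul (by positivity), ha, hb]
          congr 1
          beta_reduce
          rw [Real.mul_rpow hc.le (by positivity), mul_right_comm c t]
          ring
        simp_rw [hterm]
        rw [ENNReal.tsum_mul_left]
        refine (mul_le_mul_right (tsum_rpow_neg_half_mul_exp_le (mul_pos hc ht₀)) _).trans_eq ?_
        rw [← ENNReal.ofReal_mul (by positivity)]
        congr 1
        have hcc : c ^ (-(1 / 2) : ℝ) * c ^ (-(1 / 2) : ℝ) = c⁻¹ := by
          rw [← Real.rpow_add hc, ← Real.rpow_neg_one]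
          norm_num
        have hpi : √Real.pi * √Real.pi = Real.pi := Real.mul_self_sqrt Real.pi_pos.le
        have htt : (t ^ (-(1 / 2) : ℝ))⁻¹ * t ^ (-(1 / 2) : ℝ) = 1 :=
          inv_mul_cancel₀ (Real.rpow_pos_of_pos ht₀ _).ne'
        rw [Real.mul_rpow hc.le ht₀.le]
        calc _ = (√Real.pi * √Real.pi) * (c ^ (-(1 / 2) : ℝ) * c ^ (-(1 / 2) : ℝ)) *
              ((t ^ (-(1 / 2) : ℝ))⁻¹ * t ^ (-(1 / 2) : ℝ)) := by ring
          _ = _ := by rw [hcc, hpi, htt, mul_one, div_eq_mul_inv]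
    _ = _ := by
        rw [lintegral_const_mul' _ _ ENNReal.ofReal_ne_top, lintegral_enorm_sq_eq,
          ← ENNReal.ofReal_mul (by positivity)]

/-- The norm of the Laplace integral at `x` is at most `(2 * x) ^ (-1/2)`. -/
theorem norm_laplaceFunctional_sq_le {𝕜 : Type*} [RCLike 𝕜] {x : ℝ} (hx : 0 < x)
    (f : L2HalfLine 𝕜) : ‖laplaceFunctional 𝕜 x hx f‖ ^ 2 ≤ (2 * x)⁻¹ * ‖f‖ ^ 2 := by
  -- This weight cancels the exponential in the second factor, which becomes `‖f‖²`; the first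
  -- becomes the integral of `exp (-2 * x * t)`.
  have h := enorm_laplaceFunctional_sq_le hx (w := fun t => Real.exp (-(x * t))) (by fun_prop)
    (fun t _ => Real.exp_pos _) f
  have h₁ : ∫⁻ t in Ioi (0 : ℝ), ENNReal.ofReal (Real.exp (-(x * t)) * Real.exp (-(x * t))) =
      ENNReal.ofReal ((2 * x)⁻¹) := by
    have he : ∀ t : ℝ, Real.exp (-(x * t)) * Real.exp (-(x * t)) = Real.exp (-(2 * x) * t) :=
      fun t => by rw [← Real.exp_add]; congr 1; ring
    simp_rw [he]
    rw [← ofReal_integral_eq_lintegral_ofReal (integrableOn_exp_mul_Ioi (by linarith) 0)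
      (Filter.Eventually.of_forall fun t => (Real.exp_pos _).le),
      integral_exp_mul_Ioi (by linarith) 0]
    congr 1
    simp
  simp only [inv_mul_cancel₀ (Real.exp_pos _).ne', ENNReal.ofReal_one, one_mul,
    lintegral_enorm_sq_eq, h₁] at h
  rw [← ENNReal.ofReal_mul (by positivity), ← ofReal_norm,
    ← ENNReal.ofReal_pow (norm_nonneg _)] at h
  exact (ENNReal.ofReal_le_ofReal_iff (by positivity)).1 h

open Filter Topology

/-! ### Boundedness and compactness of operators into `ℓ²` -/

/-- A square-summable family of functionals with a uniform bound is a bounded operator into `ℓ²`. -/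
theorem exists_clm_ellTwo {𝕜 E : Type*} [RCLike 𝕜] [NormedAddCommGroup E] [NormedSpace 𝕜 E]
    (φ : ℕ → E →ₗ[𝕜] 𝕜) {C : ℝ} (hC : 0 ≤ C)
    (h : ∀ f (s : Finset ℕ), ∑ n ∈ s, ‖φ n f‖ ^ 2 ≤ (C * ‖f‖) ^ 2) :
    ∃ L : E →L[𝕜] EllTwo 𝕜, ∀ f n, L f n = φ n f := by
  have hmem : ∀ f, Memℓp (fun n => φ n f) 2 := fun f =>
    memℓp_gen' (C := (C * ‖f‖) ^ 2) fun s => by simpa using h f s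
  let T : E →ₗ[𝕜] EllTwo 𝕜 :=
    { toFun := fun f => ⟨fun n => φ n f, hmem f⟩
      map_add' := fun f g => lp.ext (funext fun n => map_add (φ n) f g)
      map_smul' := fun c f => lp.ext (funext fun n => map_smul (φ n) c f) }
  refine ⟨T.mkContinuous C fun f => ?_, fun f n => rfl⟩
  exact lp.norm_le_of_forall_sum_le (by norm_num) (by positivity) fun s => by
    simpa [T] using h f s

/-- An operator into `ℓ²` whose coordinates have square-summable norms is compact. -/
theorem isCompactOperator_of_summable_sq {𝕜 E : Type*} [RCLike 𝕜] [NormedAddCommGroup E]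
    [NormedSpace 𝕜 E] (L : E →L[𝕜] EllTwo 𝕜) {a : ℕ → ℝ} (ha : Summable a)
    (h : ∀ f n, ‖L f n‖ ^ 2 ≤ a n * ‖f‖ ^ 2) : IsCompactOperator L := by
  -- Nonnegativity of `a` can be read off from `h` only if `E` has a nonzero vector.
  by_cases hE : Subsingleton E
  · refine ⟨{0}, isCompact_singleton, ?_⟩
    refine univ_mem' fun f => ?_
    simp [Subsingleton.elim f 0]
  have ha₀ : ∀ n, 0 ≤ a n := fun n => by
    have := not_subsingleton_iff_nontrivial.1 hE
    obtain ⟨f, hf⟩ := exists_ne (0 : E)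
    have hf' : 0 < ‖f‖ ^ 2 := by positivity
    exact nonneg_of_mul_nonneg_left ((sq_nonneg _).trans (h f n)) hf'
  let S : ℕ → EllTwo 𝕜 →L[𝕜] EllTwo 𝕜 := fun n =>
    (lp.singleContinuousLinearMap 𝕜 (fun _ : ℕ => 𝕜) 2 n).comp (lp.evalCLM 𝕜 (fun _ : ℕ => 𝕜) 2 n)
  have hS : ∀ n y, S n y = lp.single 2 n (y n) := fun n y => rfl
  -- `F N` keeps the first `N` coordinates of `L`, so it has finite rank, and its distance to `L` is
  -- controlled by a tail of `∑ a`.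
  let F : ℕ → E →L[𝕜] EllTwo 𝕜 := fun N => ∑ n ∈ Finset.range N, (S n).comp L
  have hF : ∀ N f m, F N f m = if m < N then L f m else 0 := by
    intro N f m
    simp only [F, sum_apply, ContinuousLinearMap.comp_apply, hS,
      lp.coeFn_sum, Finset.sum_apply, lp.single_apply]
    simp [Pi.single_apply]
  have hcompact : ∀ N, IsCompactOperator (F N) := by
    intro N
    refine (compactOperator (RingHom.id 𝕜) E (EllTwo 𝕜)).sum_mem fun n _ => ?_
    exact ((isCompactOperator_id (E := 𝕜)).comp_clm
      ((lp.evalCLM 𝕜 (fun _ : ℕ => 𝕜) 2 n).comp L)).clm_comp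
      (lp.singleContinuousLinearMap 𝕜 (fun _ : ℕ => 𝕜) 2 n)
  refine isCompactOperator_of_tendsto (F := F) (l := atTop) ?_ (Eventually.of_forall hcompact)
  rw [tendsto_iff_norm_sub_tendsto_zero]
  have ht : Tendsto (fun N => √(∑' k, a (k + N))) atTop (𝓝 0) := by
    simpa using (tendsto_sum_nat_add a).sqrt
  refine squeeze_zero (fun _ => norm_nonneg _) (fun N => ?_) ht
  refine ContinuousLinearMap.opNorm_le_bound _ (Real.sqrt_nonneg _) fun f => ?_
  refine lp.norm_le_of_tsum_le (by norm_num) (by positivity) ?_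
  have hsum : Summable fun k => a (k + N) * ‖f‖ ^ 2 :=
    ((summable_nat_add_iff N).2 ha).mul_right _
  have hcoord : ∀ m, ((F N - L) f) m = if m < N then 0 else -L f m := by
    intro m
    rw [sub_apply, lp.coeFn_sub, Pi.sub_apply, hF]
    split_ifs <;> simp
  have hs : Summable fun m => ‖((F N - L) f) m‖ ^ 2 := by
    simpa using (lp.memℓp ((F N - L) f)).summable (by norm_num)
  have h0 : ∑ m ∈ Finset.range N, ‖((F N - L) f) m‖ ^ 2 = 0 :=
    Finset.sum_eq_zero fun m hm => by
      rw [hcoord, if_pos (Finset.mem_range.1 hm), norm_zero, zero_pow two_ne_zero]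
  calc ∑' m, ‖((F N - L) f) m‖ ^ (2 : ENNReal).toReal = ∑' m, ‖((F N - L) f) m‖ ^ 2 := by simp
    _ = ∑' k, ‖((F N - L) f) (k + N)‖ ^ 2 := by rw [← hs.sum_add_tsum_nat_add N, h0, zero_add]
    _ ≤ ∑' k, a (k + N) * ‖f‖ ^ 2 := by
      refine ((summable_nat_add_iff N).2 hs).tsum_le_tsum (fun k => ?_) hsum
      rw [hcoord, if_neg (by omega), norm_neg]
      exact h f (k + N)
    _ = _ := by
      rw [tsum_mul_right, ENNReal.toReal_ofNat, Real.rpow_ofNat, mul_pow, Real.sq_sqrt]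
      exact tsum_nonneg fun k => ha₀ _

/-- The sampled Laplace transform is bounded if the sampling points grow at least linearly. -/
theorem exists_isSampledLaplaceTransform (𝕜 : Type*) [RCLike 𝕜] {c : ℝ} (hc : 0 < c)
    {x : ℕ → ℝ} (hcx : ∀ n : ℕ, c * ((n : ℝ) + 1) ≤ x n) :
    ∃ L : L2HalfLine 𝕜 →L[𝕜] EllTwo 𝕜, IsSampledLaplaceTransform (fun _ => 1) x L := by
  have hx : ∀ n, 0 < x n := fun n => (by positivity : 0 < c * ((n : ℝ) + 1)).trans_le (hcx n)
  obtain ⟨L, hL⟩ := exists_clm_ellTwo (fun n => laplaceFunctional 𝕜 (x n) (hx n))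
    (C := √(Real.pi / c)) (Real.sqrt_nonneg _) fun f s => by
      have h := (ENNReal.sum_le_tsum s).trans (tsum_enorm_laplaceFunctional_sq_le hc hx hcx f)
      simp_rw [← ofReal_norm, ← ENNReal.ofReal_pow (norm_nonneg _)] at h
      rw [← ENNReal.ofReal_sum_of_nonneg (fun _ _ => by positivity),
        ENNReal.ofReal_le_ofReal_iff (by positivity)] at h
      rwa [mul_pow, Real.sq_sqrt (by positivity)]
  refine ⟨L, fun f n => ⟨integrableOn_exp_neg_mul_mul (hx n) f, ?_⟩⟩
  rw [hL, laplaceFunctional_apply, RCLike.ofReal_one, one_mul]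

section SampledTransform

variable {𝕜 : Type*} [RCLike 𝕜] {x : ℕ → ℝ} {L : L2HalfLine 𝕜 →L[𝕜] EllTwo 𝕜}

/-- Serves twice: its summability over `n` gives compactness, and its decay rules out bounded
preimages of the unit vectors. -/
theorem IsSampledLaplaceTransform.norm_apply_sq_le
    (h : IsSampledLaplaceTransform (fun _ => 1) x L) (hx : ∀ n, 0 < x n) (f : L2HalfLine 𝕜)
    (n : ℕ) : ‖L f n‖ ^ 2 ≤ (2 * x n)⁻¹ * ‖f‖ ^ 2 := by
  have := norm_laplaceFunctional_sq_le (hx n) f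
  rwa [laplaceFunctional_apply, ← one_mul (∫ t in Ioi (0 : ℝ), _), ← RCLike.ofReal_one,
    ← (h f n).2] at this

/-! ### Transforms of interval indicators -/

/-- The indicator function of `(a, b]` as an element of `L²(0,∞)`. -/
noncomputable def intervalIndicator (𝕜 : Type*) [RCLike 𝕜] (a b : ℝ) : L2HalfLine 𝕜 :=
  indicatorConstLp 2 (μ := (volume : Measure ℝ).restrict (Ioi 0))
    (measurableSet_Ioc (a := a) (b := b)) ((Measure.restrict_apply_le _ _).trans_lt measure_Ioc_lt_top).ne (1 : 𝕜)

theorem norm_intervalIndicator_sq (𝕜 : Type*) [RCLike 𝕜] {a b : ℝ} (ha : 0 ≤ a) (hab : a ≤ b) :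
    ‖intervalIndicator 𝕜 a b‖ ^ 2 = b - a := by
  have hs : Ioc a b ∩ Ioi 0 = Ioc a b := inter_eq_left.2 fun t ht => ha.trans_lt ht.1
  rw [intervalIndicator, norm_indicatorConstLp (by norm_num) (by norm_num), Measure.real,
    Measure.restrict_apply measurableSet_Ioc, hs, Real.volume_Ioc,
    ENNReal.toReal_ofReal (by linarith), norm_one, one_mul, ENNReal.toReal_ofNat,
    ← Real.sqrt_eq_rpow, Real.sq_sqrt (by linarith)]

theorem IsSampledLaplaceTransform.apply_intervalIndicator
    (h : IsSampledLaplaceTransform (fun _ => 1) x L) {a b : ℝ} (ha : 0 ≤ a) (hab : a ≤ b) (n : ℕ) :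
    L (intervalIndicator 𝕜 a b) n = ((∫ t in a..b, Real.exp (-(x n * t)) : ℝ) : 𝕜) := by
  have hs : Ioi (0 : ℝ) ∩ Ioc a b = Ioc a b := inter_eq_right.2 fun t ht => ha.trans_lt ht.1
  rw [(h _ n).2, RCLike.ofReal_one, one_mul, intervalIntegral.integral_of_le hab,
    ← integral_ofReal]
  have : (fun t : ℝ => (Real.exp (-(x n * t)) : 𝕜) * intervalIndicator 𝕜 a b t)
      =ᵐ[(volume : Measure ℝ).restrict (Ioi 0)]
      (Ioc a b).indicator fun t => (Real.exp (-(x n * t)) : 𝕜) := by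
    filter_upwards [indicatorConstLp_coeFn (p := 2) (μ := (volume : Measure ℝ).restrict (Ioi 0))
      (hs := measurableSet_Ioc (a := a) (b := b))
      (hμs := ((Measure.restrict_apply_le _ _).trans_lt measure_Ioc_lt_top).ne)
      (c := (1 : 𝕜))] with t ht
    rw [intervalIndicator, ht]
    by_cases hm : t ∈ Ioc a b <;> simp [hm]
  rw [integral_congr_ae this, setIntegral_indicator measurableSet_Ioc, hs]

/-- Translating the indicator function multiplies the transform by an exponential. -/
theorem IsSampledLaplaceTransform.apply_intervalIndicator_translate
    (h : IsSampledLaplaceTransform (fun _ => 1) x L) {T : ℝ} (hT : 0 ≤ T) (n : ℕ) :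
    L (intervalIndicator 𝕜 T (T + 1)) n =
      (Real.exp (-(x n * T)) : 𝕜) * L (intervalIndicator 𝕜 0 1) n := by
  rw [h.apply_intervalIndicator hT (by linarith), h.apply_intervalIndicator le_rfl zero_le_one,
    ← RCLike.ofReal_mul, ← intervalIntegral.integral_const_mul]
  have := intervalIntegral.integral_comp_add_right (a := 0) (b := 1)
    (fun t => Real.exp (-(x n * t))) T
  rw [zero_add, add_comm 1 T] at this
  rw [← this]
  congr 2
  refine funext fun t => ?_
  rw [← Real.exp_add]
  congr 1
  ring

/-! ### Ill-posedness -/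

/-- If the range is closed, it contains every unit vector. -/
theorem IsSampledLaplaceTransform.single_mem_range
    (h : IsSampledLaplaceTransform (fun _ => 1) x L) (hx : StrictMono x)
    (hcl : IsClosed (range L)) (m : ℕ) : ∀ c : 𝕜, lp.single 2 m c ∈ L.range := by
  induction m using Nat.strong_induction_on with
  | _ m ih =>
  set g := L (intervalIndicator 𝕜 0 1) with hg
  have hgm : g m ≠ 0 := by
    rw [hg, h.apply_intervalIndicator le_rfl zero_le_one, RCLike.ofReal_ne_zero]
    exact (intervalIntegral.intervalIntegral_pos_of_pos
      (Continuous.intervalIntegrable (by fun_prop) _ _) (fun t => Real.exp_pos _) zero_lt_one).ne'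
  suffices hmem : (lp.single 2 m (g m) : EllTwo 𝕜) ∈ L.range by
    intro c
    have := L.range.smul_mem (c / g m) hmem
    rwa [← lp.single_smul, smul_eq_mul, div_mul_cancel₀ _ hgm] at this
  -- Coordinates below `m` are removed inside the range by induction. The factor `exp (x m * T)`
  -- restores coordinate `m` to `g m`, while every later one decays in `T`.
  let w : ℕ → EllTwo 𝕜 := fun T => (Real.exp (x m * T) : 𝕜) •
    (L (intervalIndicator 𝕜 T (T + 1)) -
      ∑ k ∈ Finset.range m, lp.single 2 k (L (intervalIndicator 𝕜 T (T + 1)) k))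
  have hw : ∀ T, w T ∈ range L := fun T => L.range.smul_mem _ (L.range.sub_mem ⟨_, rfl⟩
    (L.range.sum_mem fun k hk => ih k (Finset.mem_range.1 hk) _))
  have hwn : ∀ T n, w T n = if n < m then 0 else
      (Real.exp (-((x n - x m) * T)) : 𝕜) * g n := by
    intro T n
    have hs : (∑ k ∈ Finset.range m, lp.single 2 k (L (intervalIndicator 𝕜 T (T + 1)) k) :
        EllTwo 𝕜) n = if n < m then L (intervalIndicator 𝕜 T (T + 1)) n else 0 := by
      simp only [lp.coeFn_sum, Finset.sum_apply, lp.single_apply]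
      simp [Pi.single_apply]
    simp only [w, lp.coeFn_smul, Pi.smul_apply, lp.coeFn_sub, Pi.sub_apply, hs]
    split_ifs
    · simp
    · rw [sub_zero, h.apply_intervalIndicator_translate (Nat.cast_nonneg T), smul_eq_mul,
        ← mul_assoc, ← RCLike.ofReal_mul, ← Real.exp_add]
      congr 3
      ring
  -- By monotonicity the gap `x n - x m` for `n > m` is smallest at `n = m + 1`, which gives a decay
  -- rate uniform in `n`.
  have hbound : ∀ T : ℕ, ‖w T - lp.single 2 m (g m)‖ ≤
      Real.exp (-((x (m + 1) - x m) * T)) * ‖g‖ := by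
    intro T
    have : ‖(Real.exp (-((x (m + 1) - x m) * T)) : 𝕜) • g‖ =
        Real.exp (-((x (m + 1) - x m) * T)) * ‖g‖ := by
      rw [norm_smul, RCLike.norm_ofReal, abs_of_pos (Real.exp_pos _)]
    rw [← this]
    refine lp.norm_mono (by norm_num) fun n => ?_
    rw [lp.coeFn_sub, Pi.sub_apply, hwn, lp.single_apply, lp.coeFn_smul, Pi.smul_apply]
    rcases lt_trichotomy n m with hn | rfl | hn
    · rw [if_pos hn, Pi.single_eq_of_ne hn.ne, sub_zero, norm_zero]
      exact norm_nonneg _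
    · rw [if_neg (lt_irrefl n), Pi.single_eq_same, sub_self, zero_mul, neg_zero, Real.exp_zero,
        RCLike.ofReal_one, one_mul, sub_self, norm_zero]
      exact norm_nonneg _
    · rw [if_neg hn.not_gt, Pi.single_eq_of_ne hn.ne', sub_zero, norm_mul, norm_smul,
        RCLike.norm_ofReal, RCLike.norm_ofReal, abs_of_pos (Real.exp_pos _),
        abs_of_pos (Real.exp_pos _)]
      gcongr
      exact hx.monotone hn
  refine hcl.mem_of_tendsto (f := w) (b := atTop) ?_ (Eventually.of_forall hw)
  rw [tendsto_iff_norm_sub_tendsto_zero]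
  refine squeeze_zero (fun _ => norm_nonneg _) hbound ?_
  rw [← zero_mul ‖g‖]
  refine Tendsto.mul_const _ (Real.tendsto_exp_neg_atTop_nhds_zero.comp ?_)
  exact tendsto_natCast_atTop_atTop.const_mul_atTop (sub_pos.2 (hx (Nat.lt_succ_self m)))

/-- The inversion of the sampled Laplace transform is ill-posed if the sampling points increase to
infinity. -/
theorem IsSampledLaplaceTransform.isIllPosed
    (h : IsSampledLaplaceTransform (fun _ => 1) x L) (hx₀ : ∀ n, 0 < x n) (hx : StrictMono x)
    (hlim : Tendsto x atTop atTop) : IsIllPosed L := by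
  intro hcl
  have hsurj : Function.Surjective L := fun y =>
    hcl.mem_of_tendsto (lp.hasSum_single ENNReal.ofNat_ne_top y) (Eventually.of_forall fun s =>
      L.range.sum_mem fun k _ => h.single_mem_range hx hcl k (y k))
  obtain ⟨C, hC, hpre⟩ := L.exists_preimage_norm_le hsurj
  -- A preimage of the `n`-th unit vector with norm at most `C` would force `2 * x n ≤ C ^ 2`.
  obtain ⟨n, hn⟩ := (hlim.eventually_gt_atTop (C ^ 2)).exists
  obtain ⟨f, hf, hfC⟩ := hpre (lp.single 2 n 1)
  have hle := h.norm_apply_sq_le hx₀ f n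
  rw [lp.norm_single (by norm_num), norm_one, mul_one] at hfC
  rw [hf, lp.single_apply_self, norm_one, one_pow] at hle
  have hxn := hx₀ n
  have h₁ : ‖f‖ ^ 2 ≤ C ^ 2 := pow_le_pow_left₀ (norm_nonneg _) hfC 2
  rw [inv_mul_eq_div, le_div_iff₀ (by positivity)] at hle
  linarith

/-! ### Non-compactness under linear growth -/

/-- The sampled Laplace transform is not compact if the sampling points grow at most linearly. -/
theorem IsSampledLaplaceTransform.not_isCompactOperator
    (h : IsSampledLaplaceTransform (fun _ => 1) x L) (hx₀ : ∀ n, 0 < x n)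
    (hx : ∀ n : ℕ, x n ≤ n + 1) : ¬ IsCompactOperator L := by
  intro hcomp
  let f : ℕ → L2HalfLine 𝕜 := fun k =>
    (√((k : ℝ) + 1) : 𝕜) • intervalIndicator 𝕜 0 (1 / ((k : ℝ) + 1))
  have hk : ∀ k : ℕ, (0 : ℝ) < (k : ℝ) + 1 := fun k => by positivity
  have hf : ∀ k, ‖f k‖ = 1 := by
    intro k
    rw [← sq_eq_sq₀ (norm_nonneg _) zero_le_one, norm_smul, mul_pow,
      norm_intervalIndicator_sq 𝕜 le_rfl (by positivity), RCLike.norm_ofReal, sq_abs,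
      Real.sq_sqrt (hk k).le, sub_zero, mul_one_div_cancel (hk k).ne', one_pow]
  have hLf : ∀ k n, ‖L (f k) n‖ =
      √((k : ℝ) + 1) * ∫ t in (0 : ℝ)..(1 / ((k : ℝ) + 1)), Real.exp (-(x n * t)) := by
    intro k n
    have hpos : 0 ≤ ∫ t in (0 : ℝ)..(1 / ((k : ℝ) + 1)), Real.exp (-(x n * t)) :=
      intervalIntegral.integral_nonneg (by positivity) fun t _ => (Real.exp_pos _).le
    rw [map_smul, lp.coeFn_smul, Pi.smul_apply,
      h.apply_intervalIndicator le_rfl (by positivity), norm_smul, RCLike.norm_ofReal,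
      RCLike.norm_ofReal, abs_of_nonneg hpos, abs_of_nonneg (Real.sqrt_nonneg _)]
  have hint : ∀ n a b, IntervalIntegrable (fun t => Real.exp (-(x n * t))) volume a b :=
    fun n a b => Continuous.intervalIntegrable (by fun_prop) _ _
  have hsq : ∀ k : ℕ, √((k : ℝ) + 1) * (1 / ((k : ℝ) + 1)) = 1 / √((k : ℝ) + 1) := by
    intro k
    rw [mul_one_div, Real.sqrt_div_self']
  have hupper : ∀ k n, ‖L (f k) n‖ ≤ 1 / √((k : ℝ) + 1) := by
    intro k n
    rw [hLf, ← hsq]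
    refine mul_le_mul_of_nonneg_left ?_ (Real.sqrt_nonneg _)
    have := intervalIntegral.integral_mono_on (a := 0) (b := 1 / ((k : ℝ) + 1)) (by positivity)
      (hint n _ _) (g := fun _ => 1) intervalIntegrable_const fun t ht =>
        Real.exp_le_one_iff.2 (neg_nonpos.2 (mul_nonneg (hx₀ n).le ht.1))
    simpa using this
  -- For `n ≤ k` the exponent `x n * t` is at most `1` on the support of `f k`. These `k + 1`
  -- coordinates together contribute at least `exp (-1) ^ 2` to the squared norm.
  have hlower : ∀ k n : ℕ, n ≤ k → Real.exp (-1) / √((k : ℝ) + 1) ≤ ‖L (f k) n‖ := by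
    intro k n hnk
    have hnk' : (n : ℝ) ≤ k := by exact_mod_cast hnk
    rw [hLf, div_eq_mul_one_div, ← hsq, mul_left_comm]
    refine mul_le_mul_of_nonneg_left ?_ (Real.sqrt_nonneg _)
    have := intervalIntegral.integral_mono_on (a := 0) (b := 1 / ((k : ℝ) + 1)) (by positivity)
      (f := fun _ => Real.exp (-1)) intervalIntegrable_const (hint n _ _) fun t ht => by
        have h₁ : x n * t ≤ ((k : ℝ) + 1) * (1 / ((k : ℝ) + 1)) :=
          mul_le_mul (by linarith [hx n]) ht.2 ht.1 (hk k).le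
        rw [mul_one_div_cancel (hk k).ne'] at h₁
        exact Real.exp_le_exp.2 (by linarith)
    simpa [mul_comm] using this
  have hnorm : ∀ k, Real.exp (-1) ≤ ‖L (f k)‖ := by
    intro k
    rw [← sq_le_sq₀ (Real.exp_pos _).le (norm_nonneg _)]
    have h₁ := lp.sum_rpow_le_norm_rpow (p := 2) (by norm_num) (L (f k)) (Finset.range (k + 1))
    simp only [ENNReal.toReal_ofNat, Real.rpow_ofNat] at h₁
    refine le_trans ?_ h₁
    calc Real.exp (-1) ^ 2
        = ∑ _n ∈ Finset.range (k + 1), (Real.exp (-1) / √((k : ℝ) + 1)) ^ 2 := by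
          rw [Finset.sum_const, Finset.card_range, nsmul_eq_mul, div_pow, Real.sq_sqrt (hk k).le]
          push_cast
          field_simp
      _ ≤ _ := Finset.sum_le_sum fun n hn => pow_le_pow_left₀ (by positivity)
          (hlower k n (Finset.mem_range_succ_iff.1 hn)) 2
  obtain ⟨K, hK, hKf⟩ := IsCompactOperator.image_closedBall_subset_compact (f := (L : L2HalfLine 𝕜 →ₗ[𝕜] EllTwo 𝕜))
    hcomp 1
  obtain ⟨y, -, φ, hφ, hy⟩ := hK.tendsto_subseq (x := fun k => L (f k)) fun k =>
    hKf ⟨f k, by simp [hf], rfl⟩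
  -- A norm limit is also a coordinatewise limit, and the coordinates tend to zero by `hupper`.
  have hy₀ : y = 0 := by
    refine lp.ext (funext fun n => ?_)
    have h₁ : Tendsto (fun k => L (f (φ k)) n) atTop (𝓝 (y n)) :=
      ((lp.evalCLM 𝕜 (fun _ : ℕ => 𝕜) 2 n).continuous.tendsto y).comp hy
    refine tendsto_nhds_unique h₁ ?_
    have h₂ : Tendsto (fun k : ℕ => 1 / √((k : ℝ) + 1)) atTop (𝓝 0) := by
      have := (tendsto_one_div_add_atTop_nhds_zero_nat (𝕜 := ℝ)).sqrt
      simpa using this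
    exact squeeze_zero_norm (fun k => hupper _ n) (h₂.comp hφ.tendsto_atTop)
  have h₃ := ge_of_tendsto' hy.norm fun k => hnorm (φ k)
  rw [hy₀, norm_zero] at h₃
  exact h₃.not_gt (Real.exp_pos _)

end SampledTransform

/-! ### The two families of sampling points -/

theorem mainTheorem6 (𝕜 : Type*) [RCLike 𝕜] (s : ℝ) (hs₀ : 0 < s) (hs₁ : s < 1) :
    (∃ L : L2HalfLine 𝕜 →L[𝕜] EllTwo 𝕜,
      IsSampledLaplaceTransform (fun _ => 1) (fun n : ℕ => ((n + 1 : ℕ) : ℝ) - s) L ∧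
        ¬ IsCompactOperator L ∧ IsIllPosedTypeI L) ∧
    (∀ α : ℝ, 1 < α → ∃ L : L2HalfLine 𝕜 →L[𝕜] EllTwo 𝕜,
      IsSampledLaplaceTransform (fun _ => 1) (fun n : ℕ => ((n + 1 : ℕ) : ℝ) ^ α - s) L ∧
        IsCompactOperator L ∧ IsIllPosedTypeII L) := by
  -- In both families the first sampling point is `1 - s`, so this is the largest `c` with `c * (n +
  -- 1) ≤ x n` for all `n`.
  have hc : 0 < 1 - s := sub_pos.2 hs₁
  have hlin : Tendsto (fun n : ℕ => (1 - s) * ((n : ℝ) + 1)) atTop atTop :=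
    (tendsto_atTop_add_const_right _ 1 tendsto_natCast_atTop_atTop).const_mul_atTop hc
  constructor
  · have hcx : ∀ n : ℕ, (1 - s) * ((n : ℝ) + 1) ≤ ((n + 1 : ℕ) : ℝ) - s := fun n => by
      have : 0 ≤ s * n := by positivity
      push_cast
      linarith
    have hx₀ : ∀ n : ℕ, 0 < ((n + 1 : ℕ) : ℝ) - s := fun n =>
      (by positivity : 0 < (1 - s) * ((n : ℝ) + 1)).trans_le (hcx n)
    obtain ⟨L, hL⟩ := exists_isSampledLaplaceTransform 𝕜 hc hcx
    have hnc : ¬ IsCompactOperator L := hL.not_isCompactOperator hx₀ fun n => by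
      push_cast
      linarith
    refine ⟨L, hL, hnc, hL.isIllPosed hx₀ (fun m n hmn => ?_) (tendsto_atTop_mono hcx hlin), hnc⟩
    have : (m : ℝ) < n := by exact_mod_cast hmn
    push_cast
    linarith
  · intro α hα
    have hpow : ∀ n : ℕ, (1 - s) * ((n + 1 : ℕ) : ℝ) ^ α ≤ ((n + 1 : ℕ) : ℝ) ^ α - s := fun n => by
      have h₁ : (1 : ℝ) ≤ ((n + 1 : ℕ) : ℝ) ^ α :=
        Real.one_le_rpow (by norm_num) (by linarith)
      nlinarith
    have hcx : ∀ n : ℕ, (1 - s) * ((n : ℝ) + 1) ≤ ((n + 1 : ℕ) : ℝ) ^ α - s := fun n => by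
      refine le_trans (mul_le_mul_of_nonneg_left ?_ hc.le) (hpow n)
      rw [← Nat.cast_add_one]
      exact Real.self_le_rpow_of_one_le (by norm_num) hα.le
    have hx₀ : ∀ n : ℕ, 0 < ((n + 1 : ℕ) : ℝ) ^ α - s := fun n =>
      (by positivity : 0 < (1 - s) * ((n : ℝ) + 1)).trans_le (hcx n)
    obtain ⟨L, hL⟩ := exists_isSampledLaplaceTransform 𝕜 hc hcx
    have hsum : Summable fun n : ℕ => (2 * (((n + 1 : ℕ) : ℝ) ^ α - s))⁻¹ := by
      have h₁ : Summable fun n : ℕ => (2 * (1 - s))⁻¹ * (((n + 1 : ℕ) : ℝ) ^ α)⁻¹ :=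
        ((summable_nat_add_iff 1).2 (Real.summable_nat_rpow_inv.2 hα)).mul_left _
      refine Summable.of_nonneg_of_le (fun n => ?_) (fun n => ?_) h₁
      · have := hx₀ n
        positivity
      · rw [← mul_inv, mul_assoc]
        have := hpow n
        gcongr
    have hcomp : IsCompactOperator L :=
      isCompactOperator_of_summable_sq L hsum fun f n => hL.norm_apply_sq_le hx₀ f n
    refine ⟨L, hL, hcomp, hL.isIllPosed hx₀ (fun m n hmn => ?_) (tendsto_atTop_mono hcx hlin),
      hcomp⟩
    have : ((m + 1 : ℕ) : ℝ) < (n + 1 : ℕ) := by exact_mod_cast Nat.succ_lt_succ hmn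
    exact sub_lt_sub_right (Real.rpow_lt_rpow (Nat.cast_nonneg _) this (by linarith)) s
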